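/- Let $f:(0,\infty)\to\mathbb R$ be twice differentiable, with $f/f'$ twice differentiable, and assume that $$f(x)=O(x^2),\quad f'(x)=O(x)\quad (x\to0^+),\qquad f(x)=O(x^2)\quad (x\to\infty),\qquad f''>0,\qquad (f/f')''>0 .$$ For $n\ge 2$, equip $M=(0,\infty)^n$ with the metric $$ds^2=\sum_{i=1}^n\frac{dx_i^2}{f(x_i)}-\frac{(dx_1+\cdots+dx_n)^2}{f(x_1+\cdots+x_n)} .$$ Let $\eta(x)=\int_1^x \frac{dr}{\sqrt{f(r)}}$, let $\xi=\eta^{-1}$, and let $\Phi(x_1,\dots,x_n)=(\eta(x_1),\dots,\eta(x_n),\eta(x_1+\cdots+x_n))$. The map $\Phi$ is an isometric immersion of $M$ into $\mathbb R^{n+1}$ with the Minkowski metric $dy_1^2+\cdots+dy_n^2-dy_{n+1}^2$, through which tangent vectors of $M$ are identified with tangent vectors of $\Phi(M)$. At $y=\Phi(x)$ the vectors $$e_i=\frac{\partial}{\partial y_i}+\sqrt{\frac{f(\xi(y_i))}{f(\xi(y_{n+1}))}}\,\frac{\partial}{\partial y_{n+1}},\qquad i=1,\dots,n,$$ are tangent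 to $\Phi(M)$. Write $t=x_1+\cdots+x_n$. Then for all $x\in M$ and $i\ne j$ one has $f(t)-\sum_{\ell=1}^n f(x_\ell)>0$ and $f(t)-f(x_i)-f(x_j)>0$, the vectors $e_i,e_j$ span a nondegenerate plane, and the sectional curvature of this plane is $$K(e_i,e_j)=\frac{f(x_i)f'(x_j)f'(t)+f'(x_i)f(x_j)f'(t)-f'(x_i)f'(x_j)f(t)}{4\big(f(t)-\sum_{\ell=1}^n f(x_\ell)\big)\big(f(t)-f(x_i)-f(x_j)\big)} .$$ In particular, for $n=2$ the Gaussian curvature of $M$ at $(x,y)$ (the sectional curvature computed from any two linearly independent tangent vectors) is $$K(x,y)=-\frac14\,\frac{f(t)f'(x)f'(y)-f(x)f'(t)f'(y)-f(y)f'(t)f'(x)}{\big[f(t)-f(x)-f(y)\big]^2},\qquad t=x+y .$$ -/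

import Mathlib

open Set Filter Topology Asymptotics

noncomputable section

namespace DirichletGeometry

/-! ## Riemannian geometry of an open subset of `ℝⁿ` in its standard coordinates -/

/-- The coordinate partial derivative `∂h/∂x_k` at `x`. -/
def partialDeriv {n : ℕ} (k : Fin n) (h : (Fin n → ℝ) → ℝ) (x : Fin n → ℝ) : ℝ :=
  fderiv ℝ h x (Pi.single k 1)

/-- The scalar product `g_x(u, v)` of two tangent vectors `u`, `v` at `x`, where `g x` is the
matrix of the metric at `x` in the standard coordinates. -/
def metricForm {n : ℕ} (g : (Fin n → ℝ) → Matrix (Fin n) (Fin n) ℝ)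
    (x u v : Fin n → ℝ) : ℝ :=
  ∑ i, ∑ j, g x i j * u i * v j

/-- The Christoffel symbols of the second kind of the Levi-Civita connection of `g`:
`Γ^k_{ij} = 1/2 ∑_l g^{kl} (∂_i g_{jl} + ∂_j g_{il} - ∂_l g_{ij})`. -/
def christoffel {n : ℕ} (g : (Fin n → ℝ) → Matrix (Fin n) (Fin n) ℝ)
    (k i j : Fin n) (x : Fin n → ℝ) : ℝ :=
  (1 / 2) * ∑ l, (g x)⁻¹ k l *
    (partialDeriv i (fun y => g y j l) x + partialDeriv j (fun y => g y i l) x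
      - partialDeriv l (fun y => g y i j) x)

/-- The components of the curvature tensor: `riemann g l k i j x` is the `l`-th component of
`R(∂_i, ∂_j) ∂_k = ∇_{∂_i} ∇_{∂_j} ∂_k - ∇_{∂_j} ∇_{∂_i} ∂_k` at `x`. -/
def riemann {n : ℕ} (g : (Fin n → ℝ) → Matrix (Fin n) (Fin n) ℝ)
    (l k i j : Fin n) (x : Fin n → ℝ) : ℝ :=
  partialDeriv i (christoffel g l j k) x - partialDeriv j (christoffel g l i k) x
    + ∑ m, (christoffel g l i m x * christoffel g m j k x
        - christoffel g l j m x * christoffel g m i k x)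

/-- The vector `R(u, v) w` at `x`. -/
def curvatureVec {n : ℕ} (g : (Fin n → ℝ) → Matrix (Fin n) (Fin n) ℝ)
    (x u v w : Fin n → ℝ) : Fin n → ℝ :=
  fun l => ∑ i, ∑ j, ∑ k, riemann g l k i j x * u i * v j * w k

/-- The squared area `g(u,u) g(v,v) - g(u,v)²` of the parallelogram spanned by `u`, `v`. -/
def gramDet {n : ℕ} (g : (Fin n → ℝ) → Matrix (Fin n) (Fin n) ℝ)
    (x u v : Fin n → ℝ) : ℝ :=
  metricForm g x u u * metricForm g x v v - metricForm g x u v ^ 2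

/-- The sectional curvature at `x` of the plane spanned by `u`, `v`:
`K(u, v) = g(R(u,v)v, u) / (g(u,u) g(v,v) - g(u,v)²)`. -/
def sectionalCurvature {n : ℕ} (g : (Fin n → ℝ) → Matrix (Fin n) (Fin n) ℝ)
    (x u v : Fin n → ℝ) : ℝ :=
  metricForm g x (curvatureVec g x u v v) u / gramDet g x u v

/-! ## The metric attached to a function `f` -/

/-- The standing assumptions on `f`. Only the values of `f` on the positive half-line matter;
`f` and `f / f'` are twice differentiable there, so that the two second derivatives whose
positivity is required make sense. -/
structure Admissible (f : ℝ → ℝ) : Prop where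
  differentiable : ∀ x > 0, DifferentiableAt ℝ f x
  differentiable_deriv : ∀ x > 0, DifferentiableAt ℝ (deriv f) x
  differentiable_quot : ∀ x > 0, DifferentiableAt ℝ (fun y => f y / deriv f y) x
  differentiable_deriv_quot :
    ∀ x > 0, DifferentiableAt ℝ (deriv (fun y => f y / deriv f y)) x
  isBigO_zero : f =O[𝓝[>] 0] (fun x : ℝ => x ^ 2)
  deriv_isBigO_zero : deriv f =O[𝓝[>] 0] (fun x : ℝ => x)
  isBigO_atTop : f =O[atTop] (fun x : ℝ => x ^ 2)
  deriv2_pos : ∀ x > 0, 0 < deriv (deriv f) x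
  deriv2_quot_pos : ∀ x > 0, 0 < deriv (deriv (fun y => f y / deriv f y)) x

/-- The quadrant `M = (0, ∞)ⁿ`. -/
def quadrant (n : ℕ) : Set (Fin n → ℝ) := {x | ∀ i, 0 < x i}

/-- The matrix of the metric
`ds² = dx_1²/f(x_1) + ⋯ + dx_n²/f(x_n) - (dx_1 + ⋯ + dx_n)²/f(x_1 + ⋯ + x_n)`. -/
def basicMetric {n : ℕ} (f : ℝ → ℝ) (x : Fin n → ℝ) : Matrix (Fin n) (Fin n) ℝ :=
  fun i j => (if i = j then 1 / f (x i) else 0) - 1 / f (∑ l, x l)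

/-! ## The embedding in Minkowski space and the tangent vectors `e_i` -/

/-- The scalar product of `dy_1² + ⋯ + dy_n² - dy_{n+1}²` on `ℝ^{n+1}`. -/
def minkowski {n : ℕ} (u v : Fin (n + 1) → ℝ) : ℝ :=
  ∑ i : Fin n, u i.castSucc * v i.castSucc - u (Fin.last n) * v (Fin.last n)

/-- `η(x) = ∫_1^x dr / √f(r)`. -/
def eta (f : ℝ → ℝ) (x : ℝ) : ℝ := ∫ r in (1 : ℝ)..x, 1 / √(f r)

/-- `ξ`, the inverse of `η : (0, ∞) → ℝ`. -/
def xi (f : ℝ → ℝ) : ℝ → ℝ := Function.invFunOn (eta f) (Ioi 0)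

/-- `Φ(x_1, …, x_n) = (η(x_1), …, η(x_n), η(x_1 + ⋯ + x_n))`. -/
def Phi {n : ℕ} (f : ℝ → ℝ) (x : Fin n → ℝ) : Fin (n + 1) → ℝ :=
  Fin.snoc (α := fun _ => ℝ) (fun i => eta f (x i)) (eta f (∑ i, x i))

/-- `e_i = ∂/∂y_i + √(f(ξ(y_i)) / f(ξ(y_{n+1}))) ∂/∂y_{n+1}` at the point `y`. -/
def tangentVec {n : ℕ} (f : ℝ → ℝ) (i : Fin n) (y : Fin (n + 1) → ℝ) : Fin (n + 1) → ℝ :=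
  Pi.single i.castSucc 1
    + √(f (xi f (y i.castSucc)) / f (xi f (y (Fin.last n)))) • Pi.single (Fin.last n) 1

end DirichletGeometry

end

noncomputable section
namespace DirichletGeometry

/-! ## Positivity and superadditivity -/

/-! The behaviour at `0` and `f'' > 0` give `f' > 0`, `f > 0` and strict superadditivity of `f`.
Superadditivity supplies the two positive denominators.

The curvature is computed intrinsically; `Phi` only serves to identify `e_i` with the coordinate
vector `√(f (x i)) ∂_i` (`fderiv_Phi_eq_tangentVec_iff`). The metric is a diagonal matrix minus a
rank-one matrix, so its inverse is explicit (`basicMetric_mul_invMetric`). It is moreover a Hessian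
metric: `∂_i Γ_{p,jk}` is symmetric in `i`, `j`. Once an index is lowered
(`sum_metric_mul_riemann`), all derivatives of Christoffel symbols cancel, leaving a difference of
two `g⁻¹`-products of the vectors `Γ_{·,ij}` (`sum_basicMetric_mul_riemann`). These vectors are
combinations of a basis vector and the all-ones vector, so the products are elementary
(`christoffelProd_sub`). Dividing by the Gram determinant gives the formula. For `n = 2` the
symmetries of the curvature tensor make the quotient independent of the basis. -/

theorem lt_of_strictMonoOn_of_tendsto {g : ℝ → ℝ} {c x : ℝ} (hg : StrictMonoOn g (Ioi 0))
    (hc : Tendsto g (𝓝[>] 0) (𝓝 c)) (hx : 0 < x) : c < g x := by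
  -- Passing to the limit gives only `c ≤ g (x / 2)`; the step from `x / 2` to `x` restores
  -- strictness.
  have h2 : 0 < x / 2 := by positivity
  refine lt_of_le_of_lt (le_of_tendsto hc ?_) (hg (mem_Ioi.2 h2) (mem_Ioi.2 hx) (by linarith))
  filter_upwards [Ioo_mem_nhdsGT h2] with y hy
  exact (hg (mem_Ioi.2 hy.1) (mem_Ioi.2 h2) hy.2).le

theorem strictMonoOn_Ioi_of_deriv_pos {g : ℝ → ℝ} (hd : ∀ x > 0, DifferentiableAt ℝ g x)
    (hg : ∀ x > 0, 0 < deriv g x) : StrictMonoOn g (Ioi 0) := by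
  refine strictMonoOn_of_deriv_pos (convex_Ioi 0)
    (fun x hx => (hd x hx).continuousAt.continuousWithinAt) fun x hx => ?_
  rw [interior_Ioi] at hx
  exact hg x hx

theorem sum_pos_of_mem_quadrant {n : ℕ} [NeZero n] {x : Fin n → ℝ}
    (hx : x ∈ quadrant n) : 0 < ∑ i, x i :=
  Finset.sum_pos (fun i _ => hx i) Finset.univ_nonempty

namespace Admissible

variable {f : ℝ → ℝ} (hf : Admissible f)
include hf

theorem tendsto_deriv_zero : Tendsto (deriv f) (𝓝[>] 0) (𝓝 0) :=
  hf.deriv_isBigO_zero.trans_tendsto (tendsto_id.mono_left nhdsWithin_le_nhds)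

theorem tendsto_zero : Tendsto f (𝓝[>] 0) (𝓝 0) := by
  refine hf.isBigO_zero.trans_tendsto (Tendsto.mono_left ?_ nhdsWithin_le_nhds)
  simpa using (continuous_pow 2).tendsto (0 : ℝ)

theorem strictMonoOn_deriv : StrictMonoOn (deriv f) (Ioi 0) :=
  strictMonoOn_Ioi_of_deriv_pos hf.differentiable_deriv hf.deriv2_pos

theorem deriv_pos {x : ℝ} (hx : 0 < x) : 0 < deriv f x :=
  lt_of_strictMonoOn_of_tendsto hf.strictMonoOn_deriv hf.tendsto_deriv_zero hx

theorem pos {x : ℝ} (hx : 0 < x) : 0 < f x :=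
  lt_of_strictMonoOn_of_tendsto
    (strictMonoOn_Ioi_of_deriv_pos hf.differentiable fun _ h => hf.deriv_pos h) hf.tendsto_zero hx

/-- Since `f'` increases, so does `s ↦ f (s + a) - f s`, and its limit at `0` is `f a`. -/
theorem add_lt {a b : ℝ} (ha : 0 < a) (hb : 0 < b) : f a + f b < f (a + b) := by
  have hD : ∀ x > 0, HasDerivAt (fun s => f (s + a) - f s) (deriv f (x + a) - deriv f x) x :=
    fun x hx => ((hf.differentiable (x + a) (by positivity)).hasDerivAt.comp_add_const x a).sub
      (hf.differentiable x hx).hasDerivAt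
  have hm : StrictMonoOn (fun s => f (s + a) - f s) (Ioi 0) := by
    refine strictMonoOn_Ioi_of_deriv_pos (fun x hx => (hD x hx).differentiableAt) fun x hx => ?_
    rw [(hD x hx).deriv, sub_pos]
    exact hf.strictMonoOn_deriv (mem_Ioi.2 hx) (mem_Ioi.2 (by positivity)) (by linarith)
  have ht : Tendsto (fun s => f (s + a) - f s) (𝓝[>] 0) (𝓝 (f a - 0)) := by
    refine Tendsto.sub (Tendsto.mono_left ?_ nhdsWithin_le_nhds) hf.tendsto_zero
    have h1 : Tendsto (fun s : ℝ => s + a) (𝓝 0) (𝓝 a) := by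
      simpa using (continuous_add_const a).tendsto (0 : ℝ)
    exact (hf.differentiable a ha).continuousAt.tendsto.comp h1
  have := lt_of_strictMonoOn_of_tendsto hm ht hb
  simp only [add_comm b a] at this
  linarith

theorem sum_le {ι : Type*} {s : Finset ι} (hs : s.Nonempty) {x : ι → ℝ} (hx : ∀ i, 0 < x i) :
    ∑ i ∈ s, f (x i) ≤ f (∑ i ∈ s, x i) := by
  induction hs using Finset.Nonempty.cons_induction with
  | singleton a => simp
  | cons a s h hs ih =>
    rw [Finset.sum_cons, Finset.sum_cons]
    linarith [hf.add_lt (hx a) (Finset.sum_pos (fun i _ => hx i) hs)]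

theorem sum_lt {ι : Type*} [Fintype ι] [Nontrivial ι] {x : ι → ℝ} (hx : ∀ i, 0 < x i) :
    ∑ i, f (x i) < f (∑ i, x i) := by
  classical
  obtain ⟨i, j, hij⟩ := exists_pair_ne ι
  have hs : (Finset.univ.erase i).Nonempty := ⟨j, by simp [hij.symm]⟩
  rw [← Finset.add_sum_erase _ _ (Finset.mem_univ i), ← Finset.add_sum_erase _ _ (Finset.mem_univ i)]
  linarith [hf.add_lt (hx i) (Finset.sum_pos (fun i _ => hx i) hs), hf.sum_le hs hx]

theorem add_lt_sum {ι : Type*} [Fintype ι] {x : ι → ℝ} (hx : ∀ i, 0 < x i) {i j : ι}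
    (hij : i ≠ j) : f (x i) + f (x j) < f (∑ i, x i) := by
  classical
  have : Nontrivial ι := ⟨i, j, hij⟩
  refine lt_of_le_of_lt ?_ (hf.sum_lt hx)
  rw [← Finset.sum_pair (f := fun i => f (x i)) hij]
  exact Finset.sum_le_sum_of_subset_of_nonneg (Finset.subset_univ _)
    fun k _ _ => (hf.pos (hx k)).le

/-! ## The embedding -/

theorem hasDerivAt_eta {x : ℝ} (hx : 0 < x) : HasDerivAt (eta f) (1 / √(f x)) x := by
  have hc : ∀ y > 0, ContinuousAt (fun r => 1 / √(f r)) y := fun y hy =>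
    continuousAt_const.div (hf.differentiable y hy).continuousAt.sqrt
      (Real.sqrt_pos.2 (hf.pos hy)).ne'
  refine intervalIntegral.integral_hasDerivAt_right ?_ ?_ (hc x hx)
  · refine ContinuousOn.intervalIntegrable fun y hy => (hc y ?_).continuousWithinAt
    exact lt_of_lt_of_le (lt_min one_pos hx) hy.1
  · exact ContinuousOn.stronglyMeasurableAtFilter isOpen_Ioi
      (fun y hy => (hc y hy).continuousWithinAt) x hx

theorem xi_eta {x : ℝ} (hx : 0 < x) : xi f (eta f x) = x := by
  refine InjOn.leftInvOn_invFunOn (StrictMonoOn.injOn ?_) hx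
  refine strictMonoOn_Ioi_of_deriv_pos (fun y hy => (hf.hasDerivAt_eta hy).differentiableAt)
    fun y hy => ?_
  rw [(hf.hasDerivAt_eta hy).deriv]
  have := Real.sqrt_pos.2 (hf.pos hy)
  positivity

end Admissible

theorem hasFDerivAt_comp_apply {n : ℕ} {φ : ℝ → ℝ} {d : ℝ} {x : Fin n → ℝ} (i : Fin n)
    (h : HasDerivAt φ d (x i)) :
    HasFDerivAt (fun y : Fin n → ℝ => φ (y i))
      (d • ContinuousLinearMap.proj (R := ℝ) (φ := fun _ : Fin n => ℝ) i) x :=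
  h.comp_hasFDerivAt x (hasFDerivAt_apply i x)

theorem hasFDerivAt_comp_sum {n : ℕ} {φ : ℝ → ℝ} {d : ℝ} {x : Fin n → ℝ}
    (h : HasDerivAt φ d (∑ i, x i)) :
    HasFDerivAt (fun y : Fin n → ℝ => φ (∑ i, y i))
      (d • ∑ i, ContinuousLinearMap.proj (R := ℝ) (φ := fun _ : Fin n => ℝ) i) x :=
  h.comp_hasFDerivAt x (HasFDerivAt.fun_sum fun i _ => hasFDerivAt_apply i x)

section Phi
variable {f : ℝ → ℝ} (hf : Admissible f) {n : ℕ} [NeZero n] {x : Fin n → ℝ} (hx : x ∈ quadrant n)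
include hf hx

theorem differentiableAt_Phi : DifferentiableAt ℝ (Phi f) x := by
  rw [differentiableAt_pi]
  intro i
  induction i using Fin.lastCases with
  | last =>
    simpa [Phi] using (hasFDerivAt_comp_sum
      (hf.hasDerivAt_eta (sum_pos_of_mem_quadrant hx))).differentiableAt
  | cast i =>
    simpa [Phi] using (hasFDerivAt_comp_apply i (hf.hasDerivAt_eta (hx i))).differentiableAt

theorem fderiv_Phi_castSucc (u : Fin n → ℝ) (i : Fin n) :
    fderiv ℝ (Phi f) x u i.castSucc = u i / √(f (x i)) := by
  have key := congrArg (fun L : (Fin n → ℝ) →L[ℝ] ℝ => L u)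
    (fderiv_apply (differentiableAt_Phi hf hx) i.castSucc)
  refine key.symm.trans ?_
  have := (hasFDerivAt_comp_apply i (hf.hasDerivAt_eta (hx i))).fderiv
  simp only [Phi, Fin.snoc_castSucc]
  rw [this]
  simp; ring

theorem fderiv_Phi_last (u : Fin n → ℝ) :
    fderiv ℝ (Phi f) x u (Fin.last n) = (∑ i, u i) / √(f (∑ i, x i)) := by
  have key := congrArg (fun L : (Fin n → ℝ) →L[ℝ] ℝ => L u)
    (fderiv_apply (differentiableAt_Phi hf hx) (Fin.last n))
  refine key.symm.trans ?_
  have := (hasFDerivAt_comp_sum (hf.hasDerivAt_eta (sum_pos_of_mem_quadrant hx))).fderiv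
  simp only [Phi, Fin.snoc_last]
  rw [this]
  simp [Finset.mul_sum, div_eq_inv_mul]

theorem tangentVec_Phi (i : Fin n) :
    tangentVec f i (Phi f x) = Pi.single i.castSucc 1 +
      (√(f (x i)) / √(f (∑ l, x l))) • Pi.single (Fin.last n) 1 := by
  rw [tangentVec, Phi, Fin.snoc_castSucc, Fin.snoc_last, hf.xi_eta (hx i),
    hf.xi_eta (sum_pos_of_mem_quadrant hx), Real.sqrt_div (hf.pos (hx i)).le]

/-- The first `n` components of the differential determine `u`; that the last one then agrees is the
tangency of `e_i`. -/
theorem fderiv_Phi_eq_tangentVec_iff (u : Fin n → ℝ) (i : Fin n) :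
    fderiv ℝ (Phi f) x u = tangentVec f i (Phi f x) ↔ u = Pi.single i (√(f (x i))) := by
  rw [tangentVec_Phi hf hx]
  constructor
  · intro h
    ext k
    have hk := congrFun h k.castSucc
    have hp := Real.sqrt_pos.2 (hf.pos (hx k))
    rw [fderiv_Phi_castSucc hf hx, div_eq_iff hp.ne'] at hk
    rw [hk]
    rcases eq_or_ne k i with rfl | hki
    · simp [(Fin.castSucc_lt_last k).ne]
    · simp [hki, (Fin.castSucc_lt_last k).ne]
  · rintro rfl
    ext k
    induction k using Fin.lastCases with
    | last => rw [fderiv_Phi_last hf hx]; simp [(Fin.castSucc_lt_last i).ne']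
    | cast k =>
      rw [fderiv_Phi_castSucc hf hx]
      have hp := Real.sqrt_pos.2 (hf.pos (hx k))
      rcases eq_or_ne k i with rfl | hki
      · simp [(Fin.castSucc_lt_last k).ne, hp.ne']
      · simp [hki, (Fin.castSucc_lt_last k).ne]

theorem injective_fderiv_Phi : Function.Injective (fderiv ℝ (Phi f) x) := by
  intro u v h
  ext k
  have hk := congrFun h k.castSucc
  have hp := Real.sqrt_pos.2 (hf.pos (hx k))
  rw [fderiv_Phi_castSucc hf hx, fderiv_Phi_castSucc hf hx] at hk
  field_simp at hk
  exact hk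

end Phi

theorem metricForm_basicMetric (f : ℝ → ℝ) {n : ℕ} (x u v : Fin n → ℝ) :
    metricForm (basicMetric f) x u v =
      ∑ i, u i * v i / f (x i) - (∑ i, u i) * (∑ i, v i) / f (∑ i, x i) := by
  have h : ∀ i, ∑ j, basicMetric f x i j * u i * v j =
      u i * v i / f (x i) - u i * (∑ j, v j) / f (∑ i, x i) := by
    intro i
    simp only [basicMetric, sub_mul, Finset.sum_sub_distrib, ite_mul, zero_mul,
      Finset.sum_ite_eq, Finset.mem_univ, if_true]
    rw [Finset.mul_sum, Finset.sum_div]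
    congr 1
    · ring
    · exact Finset.sum_congr rfl fun j _ => by ring
  simp only [metricForm, h, Finset.sum_sub_distrib]
  rw [Finset.sum_mul, Finset.sum_div]

theorem minkowski_fderiv_Phi {f : ℝ → ℝ} (hf : Admissible f) {n : ℕ} [NeZero n] {x : Fin n → ℝ}
    (hx : x ∈ quadrant n) (u v : Fin n → ℝ) :
    minkowski (fderiv ℝ (Phi f) x u) (fderiv ℝ (Phi f) x v) =
      metricForm (basicMetric f) x u v := by
  simp only [minkowski, fderiv_Phi_castSucc hf hx, fderiv_Phi_last hf hx, metricForm_basicMetric]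
  congr 1
  · refine Finset.sum_congr rfl fun i _ => ?_
    rw [div_mul_div_comm, Real.mul_self_sqrt (hf.pos (hx i)).le]
  · rw [div_mul_div_comm, Real.mul_self_sqrt (hf.pos (sum_pos_of_mem_quadrant hx)).le]

/-! ## The curvature tensor with the first index lowered -/

theorem partialDeriv_sum_mul {n : ℕ} {a b : Fin n → (Fin n → ℝ) → ℝ} {x : Fin n → ℝ}
    (ha : ∀ l, DifferentiableAt ℝ (a l) x) (hb : ∀ l, DifferentiableAt ℝ (b l) x) (k : Fin n) :
    partialDeriv k (fun y => ∑ l, a l y * b l y) x =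
      ∑ l, (partialDeriv k (a l) x * b l x + a l x * partialDeriv k (b l) x) := by
  have h := (HasFDerivAt.fun_sum (u := Finset.univ)
    fun l _ => (ha l).hasFDerivAt.mul (hb l).hasFDerivAt).fderiv
  simp only [partialDeriv]
  simp only [Pi.mul_apply] at h
  rw [h, sum_apply]
  refine Finset.sum_congr rfl fun l _ => ?_
  simp
  ring

/-- By the product rule, `g ∂Γ = ∂(gΓ) - (∂g)Γ`. Metric compatibility `hgG` splits `∂g` into two
terms: one cancels the quadratic part of the curvature, the other is the quadratic part that
remains. -/
theorem sum_metric_mul_riemann {n : ℕ} {g : (Fin n → ℝ) → Matrix (Fin n) (Fin n) ℝ}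
    {G : Fin n → Fin n → Fin n → (Fin n → ℝ) → ℝ} {x : Fin n → ℝ}
    (hG : ∀ᶠ y in 𝓝 x, ∀ p j k, ∑ l, g y p l * christoffel g l j k y = G p j k y)
    (hg : ∀ p l, DifferentiableAt ℝ (fun y => g y p l) x)
    (hc : ∀ l j k, DifferentiableAt ℝ (christoffel g l j k) x)
    (hgG : ∀ i p l, partialDeriv i (fun y => g y p l) x = G p i l x + G l i p x)
    (p k i j : Fin n) :
    ∑ l, g x p l * riemann g l k i j x =
      partialDeriv i (G p j k) x - partialDeriv j (G p i k) x
        + ∑ m, (G m j p x * christoffel g m i k x - G m i p x * christoffel g m j k x) := by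
  have key : ∀ i j, partialDeriv i (G p j k) x =
      ∑ l, ((G p i l x + G l i p x) * christoffel g l j k x
        + g x p l * partialDeriv i (christoffel g l j k) x) := by
    intro i j
    have h : (fun y => ∑ l, g y p l * christoffel g l j k y) =ᶠ[𝓝 x] G p j k :=
      hG.mono fun y hy => hy p j k
    rw [partialDeriv, ← h.fderiv_eq, ← partialDeriv,
      partialDeriv_sum_mul (a := fun l y => g y p l) (hg p) (fun l => hc l j k)]
    exact Finset.sum_congr rfl fun l _ => by rw [hgG]
  have hsum : ∀ i j, ∑ l, g x p l * ∑ m, christoffel g l i m x * christoffel g m j k x =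
      ∑ m, G p i m x * christoffel g m j k x := by
    intro i j
    simp only [Finset.mul_sum]
    rw [Finset.sum_comm]
    refine Finset.sum_congr rfl fun m _ => ?_
    rw [← hG.self_of_nhds p i m, Finset.sum_mul]
    exact Finset.sum_congr rfl fun l _ => by ring
  simp only [riemann, mul_add, mul_sub, Finset.sum_add_distrib, Finset.sum_sub_distrib, hsum, key,
    add_mul]
  ring

theorem metricForm_curvatureVec {n : ℕ} {g : (Fin n → ℝ) → Matrix (Fin n) (Fin n) ℝ}
    {x : Fin n → ℝ} (hg : ∀ p l, g x p l = g x l p) (u v w z : Fin n → ℝ) :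
    metricForm g x (curvatureVec g x u v w) z =
      ∑ p, ∑ i, ∑ j, ∑ k, (∑ l, g x p l * riemann g l k i j x) * u i * v j * w k * z p := by
  simp only [metricForm, curvatureVec]
  rw [Finset.sum_comm]
  refine Finset.sum_congr rfl fun p _ => ?_
  simp only [Finset.mul_sum, Finset.sum_mul]
  rw [Finset.sum_comm]
  refine Finset.sum_congr rfl fun i _ => ?_
  rw [Finset.sum_comm]
  refine Finset.sum_congr rfl fun j _ => ?_
  rw [Finset.sum_comm]
  refine Finset.sum_congr rfl fun k _ => Finset.sum_congr rfl fun l _ => ?_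
  rw [hg l p]
  ring

/-! ## The Levi-Civita connection of the metric attached to `f` -/

/-- The inverse of the matrix `basicMetric f x`. -/
def invMetric {n : ℕ} (f : ℝ → ℝ) (x : Fin n → ℝ) : Matrix (Fin n) (Fin n) ℝ :=
  fun k l => (if k = l then f (x k) else 0) + f (x k) * f (x l) / (f (∑ i, x i) - ∑ i, f (x i))

/-- The Christoffel symbols of the first kind `Γ_{l,ij}` of `basicMetric f`. -/
def lowerChristoffel {n : ℕ} (f : ℝ → ℝ) (l i j : Fin n) (x : Fin n → ℝ) : ℝ :=
  (1 / 2) * ((if i = j ∧ j = l then deriv (fun r => 1 / f r) (x l) else 0)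
    - deriv (fun r => 1 / f r) (∑ m, x m))

theorem basicMetric_symm (f : ℝ → ℝ) {n : ℕ} (x : Fin n → ℝ) (p l : Fin n) :
    basicMetric f x p l = basicMetric f x l p := by
  rcases eq_or_ne p l with rfl | h
  · rfl
  · simp [basicMetric, h, h.symm]

theorem invMetric_symm (f : ℝ → ℝ) {n : ℕ} (x : Fin n → ℝ) (p l : Fin n) :
    invMetric f x p l = invMetric f x l p := by
  rcases eq_or_ne p l with rfl | h
  · rfl
  · simp [invMetric, h, h.symm, mul_comm]

theorem isOpen_quadrant (n : ℕ) : IsOpen (quadrant n) := by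
  have : quadrant n = ⋂ i, {x | 0 < x i} := by ext; simp [quadrant]
  rw [this]
  exact isOpen_iInter_of_finite fun i => isOpen_lt continuous_const (continuous_apply i)

section
variable {f : ℝ → ℝ} (hf : Admissible f)
include hf

theorem Admissible.hasDerivAt_inv {r : ℝ} (hr : 0 < r) :
    HasDerivAt (fun r => 1 / f r) (-deriv f r / f r ^ 2) r := by
  simpa [one_div] using (hf.differentiable r hr).hasDerivAt.fun_inv (hf.pos hr).ne'

theorem Admissible.differentiableAt_deriv_inv {r : ℝ} (hr : 0 < r) :
    DifferentiableAt ℝ (deriv (fun r => 1 / f r)) r := by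
  have h : deriv (fun r => 1 / f r) =ᶠ[𝓝 r] fun r => -deriv f r / f r ^ 2 := by
    filter_upwards [Ioi_mem_nhds hr] with s hs
    exact (hf.hasDerivAt_inv hs).deriv
  refine DifferentiableAt.congr_of_eventuallyEq ?_ h
  exact (hf.differentiable_deriv r hr).neg.div ((hf.differentiable r hr).pow 2)
    (pow_pos (hf.pos hr) 2).ne'

variable {n : ℕ} {x : Fin n → ℝ} (hx : x ∈ quadrant n)
include hx

theorem hasFDerivAt_basicMetric [NeZero n] (i j : Fin n) :
    HasFDerivAt (fun y => basicMetric f y i j)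
      ((if i = j then deriv (fun r => 1 / f r) (x i) else 0) •
          ContinuousLinearMap.proj (R := ℝ) (φ := fun _ : Fin n => ℝ) i
        - deriv (fun r => 1 / f r) (∑ l, x l) •
          ∑ l, ContinuousLinearMap.proj (R := ℝ) (φ := fun _ : Fin n => ℝ) l) x := by
  have h1 := hasFDerivAt_comp_sum
    (hf.hasDerivAt_inv (sum_pos_of_mem_quadrant hx)).differentiableAt.hasDerivAt
  have h2 := hasFDerivAt_comp_apply i (hf.hasDerivAt_inv (hx i)).differentiableAt.hasDerivAt
  unfold basicMetric
  refine HasFDerivAt.fun_sub ?_ h1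
  split_ifs
  · exact h2
  · simpa using hasFDerivAt_const (0 : ℝ) x

theorem partialDeriv_basicMetric [NeZero n] (k i j : Fin n) :
    partialDeriv k (fun y => basicMetric f y i j) x =
      (if i = j ∧ i = k then deriv (fun r => 1 / f r) (x i) else 0)
        - deriv (fun r => 1 / f r) (∑ l, x l) := by
  rw [partialDeriv, (hasFDerivAt_basicMetric hf hx i j).fderiv]
  by_cases hij : i = j <;> by_cases hik : i = k <;> simp [hij, hik, Pi.single_apply]
  all_goals aesop

theorem hasFDerivAt_lowerChristoffel [NeZero n] (l i j : Fin n) :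
    HasFDerivAt (lowerChristoffel f l i j)
      ((1 / 2 : ℝ) • ((if i = j ∧ j = l then deriv (deriv (fun r => 1 / f r)) (x l) else 0) •
          ContinuousLinearMap.proj (R := ℝ) (φ := fun _ : Fin n => ℝ) l
        - deriv (deriv (fun r => 1 / f r)) (∑ l, x l) •
          ∑ l, ContinuousLinearMap.proj (R := ℝ) (φ := fun _ : Fin n => ℝ) l)) x := by
  have h1 := hasFDerivAt_comp_sum
    (hf.differentiableAt_deriv_inv (sum_pos_of_mem_quadrant hx)).hasDerivAt
  have h2 := hasFDerivAt_comp_apply l (hf.differentiableAt_deriv_inv (hx l)).hasDerivAt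
  unfold lowerChristoffel
  refine HasFDerivAt.const_mul (HasFDerivAt.fun_sub ?_ h1) _
  split_ifs
  · exact h2
  · simpa using hasFDerivAt_const (0 : ℝ) x

/-- With `ψ'' = 1 / f`, the metric is the Hessian of `∑ ψ(x_i) - ψ(∑ x_i)` and `Γ_{p,jk}` is half a
third derivative of this potential. This symmetry removes `f''` from the curvature. -/
theorem partialDeriv_lowerChristoffel_comm [NeZero n] (p i j k : Fin n) :
    partialDeriv i (lowerChristoffel f p j k) x = partialDeriv j (lowerChristoffel f p i k) x := by
  rw [partialDeriv, (hasFDerivAt_lowerChristoffel hf hx _ _ _).fderiv, partialDeriv,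
    (hasFDerivAt_lowerChristoffel hf hx _ _ _).fderiv]
  by_cases h1 : j = k ∧ k = p <;> by_cases h2 : i = k ∧ k = p <;>
    simp [Pi.single_apply, h1, h2] <;> grind

variable [Nontrivial (Fin n)]

/-- The Sherman–Morrison formula. At least two coordinates are needed: for `n = 1` the metric
vanishes. -/
theorem basicMetric_mul_invMetric : basicMetric f x * invMetric f x = 1 := by
  obtain ⟨i, -⟩ := exists_pair_ne (Fin n)
  have : NeZero n := ⟨by rintro rfl; exact i.elim0⟩
  have hS : f (∑ i, x i) - ∑ i, f (x i) ≠ 0 := (sub_pos.2 (hf.sum_lt hx)).ne'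
  have hF := (hf.pos (sum_pos_of_mem_quadrant hx)).ne'
  ext k l
  have hk := (hf.pos (hx k)).ne'
  have h1 : ∑ m, invMetric f x m l = f (∑ i, x i) * f (x l) / (f (∑ i, x i) - ∑ i, f (x i)) := by
    simp only [invMetric, Finset.sum_add_distrib, Finset.sum_ite_eq', Finset.mem_univ, if_true]
    rw [← Finset.sum_div, ← Finset.sum_mul]
    field_simp
    ring
  have h2 : (basicMetric f x * invMetric f x) k l =
      1 / f (x k) * invMetric f x k l - 1 / f (∑ i, x i) * ∑ m, invMetric f x m l := by
    simp only [Matrix.mul_apply, basicMetric, sub_mul, Finset.sum_sub_distrib, ite_mul, zero_mul,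
      Finset.sum_ite_eq, Finset.mem_univ, if_true, Finset.mul_sum]
  rw [h2, h1, invMetric, Matrix.one_apply]
  split_ifs
  · field_simp
    ring
  · field_simp
    ring

theorem inv_basicMetric : (basicMetric f x)⁻¹ = invMetric f x :=
  Matrix.inv_eq_right_inv (basicMetric_mul_invMetric hf hx)

theorem christoffel_basicMetric (k i j : Fin n) :
    christoffel (basicMetric f) k i j x = ∑ l, invMetric f x k l * lowerChristoffel f l i j x := by
  have : NeZero n := ⟨by rintro rfl; exact i.elim0⟩
  rw [christoffel, inv_basicMetric hf hx, Finset.mul_sum]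
  refine Finset.sum_congr rfl fun l _ => ?_
  simp only [partialDeriv_basicMetric hf hx, lowerChristoffel]
  grind

theorem sum_basicMetric_mul_christoffel (p j k : Fin n) :
    ∑ l, basicMetric f x p l * christoffel (basicMetric f) l j k x =
      lowerChristoffel f p j k x := by
  simp only [christoffel_basicMetric hf hx]
  have h := congrArg (fun A => A.mulVec (fun l => lowerChristoffel f l j k x) p)
    (basicMetric_mul_invMetric hf hx)
  simp only [← Matrix.mulVec_mulVec, Matrix.one_mulVec] at h
  exact h

theorem differentiableAt_invMetric (k l : Fin n) :
    DifferentiableAt ℝ (fun y => invMetric f y k l) x := by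
  have : NeZero n := ⟨by rintro rfl; exact k.elim0⟩
  have h1 : DifferentiableAt ℝ (fun y : Fin n → ℝ => f (∑ i, y i)) x := (hasFDerivAt_comp_sum
    (hf.differentiable _ (sum_pos_of_mem_quadrant hx)).hasDerivAt).differentiableAt
  have h2 : ∀ i, DifferentiableAt ℝ (fun y : Fin n → ℝ => f (y i)) x := fun i =>
    (hasFDerivAt_comp_apply i (hf.differentiable _ (hx i)).hasDerivAt).differentiableAt
  have h3 : DifferentiableAt ℝ (fun y : Fin n → ℝ => if k = l then f (y k) else 0) x := by
    split_ifs
    · exact h2 k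
    · exact differentiableAt_const 0
  have h4 : DifferentiableAt ℝ (fun y : Fin n → ℝ => f (∑ i, y i) - ∑ i, f (y i)) x :=
    h1.fun_sub (DifferentiableAt.fun_sum fun i _ => h2 i)
  have h5 : DifferentiableAt ℝ (fun y : Fin n → ℝ => f (y k) * f (y l)) x :=
    (h2 k).fun_mul (h2 l)
  simp only [invMetric, div_eq_mul_inv]
  exact h3.fun_add (h5.fun_mul (h4.fun_inv (sub_pos.2 (hf.sum_lt hx)).ne'))

theorem differentiableAt_christoffel (k i j : Fin n) :
    DifferentiableAt ℝ (christoffel (basicMetric f) k i j) x := by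
  have : NeZero n := ⟨by rintro rfl; exact i.elim0⟩
  have h : christoffel (basicMetric f) k i j =ᶠ[𝓝 x]
      fun y => ∑ l, invMetric f y k l * lowerChristoffel f l i j y := by
    filter_upwards [(isOpen_quadrant n).mem_nhds hx] with y hy
    exact christoffel_basicMetric hf hy k i j
  refine DifferentiableAt.congr_of_eventuallyEq ?_ h
  exact DifferentiableAt.fun_sum fun l _ => (differentiableAt_invMetric hf hx k l).mul
    (hasFDerivAt_lowerChristoffel hf hx l i j).differentiableAt

end

/-- The `g⁻¹`-product of `Γ_{·,ij}` and `Γ_{·,kl}`. -/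
def christoffelProd {n : ℕ} (f : ℝ → ℝ) (x : Fin n → ℝ) (i j k l : Fin n) : ℝ :=
  ∑ m, lowerChristoffel f m i j x * ∑ q, invMetric f x m q * lowerChristoffel f q k l x

theorem lowerChristoffel_comm (f : ℝ → ℝ) {n : ℕ} (x : Fin n → ℝ) (l i j : Fin n) :
    lowerChristoffel f l i j x = lowerChristoffel f l j i x := by
  unfold lowerChristoffel
  grind

theorem christoffelProd_comm (f : ℝ → ℝ) {n : ℕ} (x : Fin n → ℝ) (i j k l : Fin n) :
    christoffelProd f x i j k l = christoffelProd f x k l i j := by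
  simp only [christoffelProd, Finset.mul_sum]
  rw [Finset.sum_comm]
  refine Finset.sum_congr rfl fun m _ => Finset.sum_congr rfl fun q _ => ?_
  rw [invMetric_symm f x q m]
  ring

theorem christoffelProd_swap_left (f : ℝ → ℝ) {n : ℕ} (x : Fin n → ℝ) (i j k l : Fin n) :
    christoffelProd f x i j k l = christoffelProd f x j i k l := by
  simp only [christoffelProd, lowerChristoffel_comm f x _ i j]

theorem christoffelProd_swap_right (f : ℝ → ℝ) {n : ℕ} (x : Fin n → ℝ) (i j k l : Fin n) :
    christoffelProd f x i j k l = christoffelProd f x i j l k := by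
  simp only [christoffelProd, lowerChristoffel_comm f x _ k l]

/-- The `g⁻¹`-product of `a E_i + b 𝟙` and `c E_j + d 𝟙`, where `𝟙` is the all-ones vector. As `i ≠
j`, the `a c` term comes from the rank-one part of `g⁻¹` alone. -/
theorem sum_mul_sum_invMetric_mul (f : ℝ → ℝ) {n : ℕ} {x : Fin n → ℝ}
    (hS : f (∑ i, x i) - ∑ i, f (x i) ≠ 0) {i j : Fin n} (hij : i ≠ j) (a b c d : ℝ) :
    ∑ m, ((if i = m then a else 0) + b) *
        ∑ q, invMetric f x m q * ((if j = q then c else 0) + d) =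
      (a * c * f (x i) * f (x j) + a * d * f (x i) * f (∑ i, x i)
        + b * c * f (x j) * f (∑ i, x i) + b * d * (∑ i, f (x i)) * f (∑ i, x i))
        / (f (∑ i, x i) - ∑ i, f (x i)) := by
  have h1 : ∀ m, ∑ q, invMetric f x m q * ((if j = q then c else 0) + d) =
      (if j = m then c * f (x j) else 0) + f (x m) * (d + (c * f (x j) + d * ∑ i, f (x i))
        / (f (∑ i, x i) - ∑ i, f (x i))) := by
    intro m
    simp only [invMetric, mul_add, add_mul, Finset.sum_add_distrib, mul_ite, mul_zero, ite_mul,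
      zero_mul, Finset.sum_ite_eq, Finset.mem_univ, if_true]
    have h2 : ∑ q, f (x m) * f (x q) / (f (∑ i, x i) - ∑ i, f (x i)) * d =
        f (x m) * (∑ q, f (x q)) / (f (∑ i, x i) - ∑ i, f (x i)) * d := by
      rw [Finset.mul_sum, Finset.sum_div, Finset.sum_mul]
    rw [h2]
    rcases eq_or_ne j m with rfl | h
    · simp; ring
    · simp [h, h.symm]; ring
  simp only [h1]
  simp only [add_mul, mul_add, ite_mul, zero_mul, mul_ite, mul_zero, Finset.sum_add_distrib,
    Finset.sum_ite_eq, Finset.mem_univ, if_true, if_neg hij, ← Finset.mul_sum,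
    ← Finset.sum_mul]
  field_simp
  ring

/-! ### Curvature of the coordinate planes -/

section
variable {f : ℝ → ℝ} (hf : Admissible f) {n : ℕ} {x : Fin n → ℝ} (hx : x ∈ quadrant n)
include hf hx

theorem sum_basicMetric_mul_riemann [Nontrivial (Fin n)] (p k i j : Fin n) :
    ∑ l, basicMetric f x p l * riemann (basicMetric f) l k i j x =
      christoffelProd f x j p i k - christoffelProd f x i p j k := by
  have : NeZero n := ⟨by rintro rfl; exact i.elim0⟩
  rw [sum_metric_mul_riemann (G := lowerChristoffel f) (x := x)]
  · rw [partialDeriv_lowerChristoffel_comm hf hx, sub_self, zero_add, Finset.sum_sub_distrib]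
    simp only [christoffelProd, christoffel_basicMetric hf hx]
  · filter_upwards [(isOpen_quadrant n).mem_nhds hx] with y hy p j k
    exact sum_basicMetric_mul_christoffel hf hy p j k
  · exact fun p l => (hasFDerivAt_basicMetric hf hx p l).differentiableAt
  · exact differentiableAt_christoffel hf hx
  · intro i p l
    rw [partialDeriv_basicMetric hf hx]
    unfold lowerChristoffel
    grind

theorem christoffelProd_sub {i j : Fin n} (hij : i ≠ j) :
    (christoffelProd f x j i i j - christoffelProd f x i i j j) * (f (x i) * f (x j)) =
      (f (x i) * deriv f (x j) * deriv f (∑ l, x l) + deriv f (x i) * f (x j) * deriv f (∑ l, x l)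
        - deriv f (x i) * deriv f (x j) * f (∑ l, x l))
        / (4 * (f (∑ l, x l) - ∑ l, f (x l)) * f (∑ l, x l)) := by
  have : Nontrivial (Fin n) := ⟨i, j, hij⟩
  have : NeZero n := ⟨by rintro rfl; exact i.elim0⟩
  have hS : f (∑ i, x i) - ∑ i, f (x i) ≠ 0 := (sub_pos.2 (hf.sum_lt hx)).ne'
  have hF := (hf.pos (sum_pos_of_mem_quadrant hx)).ne'
  have hi := (hf.pos (hx i)).ne'
  have hj := (hf.pos (hx j)).ne'
  set β := 1 / 2 * (deriv f (∑ l, x l) / f (∑ l, x l) ^ 2) with hβ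
  set α : Fin n → ℝ := fun k => 1 / 2 * (-deriv f (x k) / f (x k) ^ 2) with hα
  have hl : ∀ k m, lowerChristoffel f m k k x = (if k = m then α k else 0) + β := by
    intro k m
    rw [lowerChristoffel, (hf.hasDerivAt_inv (hx m)).deriv,
      (hf.hasDerivAt_inv (sum_pos_of_mem_quadrant hx)).deriv, hβ, hα]
    rcases eq_or_ne k m with rfl | h
    · simp; ring
    · simp [h]; ring
  have hl' : ∀ k k' m, k ≠ k' → lowerChristoffel f m k k' x = β := by
    intro k k' m h
    rw [lowerChristoffel, (hf.hasDerivAt_inv (sum_pos_of_mem_quadrant hx)).deriv, hβ]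
    simp [h]; ring
  -- The zero coefficients put this product in the form of `sum_mul_sum_invMetric_mul`; the `β ^ 2`
  -- terms then cancel between `e1` and `e2`.
  have e1 : christoffelProd f x j i i j =
      ∑ m, ((if i = m then 0 else 0) + β) *
        ∑ q, invMetric f x m q * ((if j = q then 0 else 0) + β) := by
    simp only [christoffelProd, hl' _ _ _ hij, hl' _ _ _ hij.symm, ite_self, zero_add]
  have e2 : christoffelProd f x i i j j =
      ∑ m, ((if i = m then α i else 0) + β) *
        ∑ q, invMetric f x m q * ((if j = q then α j else 0) + β) := by
    simp only [christoffelProd, hl]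
  rw [e1, e2, sum_mul_sum_invMetric_mul f hS hij, sum_mul_sum_invMetric_mul f hS hij, hβ, hα]
  field_simp
  ring

end

theorem basicMetric_curvature_single {f : ℝ → ℝ} (hf : Admissible f) {n : ℕ} {x : Fin n → ℝ}
    (hx : x ∈ quadrant n) {i j : Fin n} (hij : i ≠ j) (a b : ℝ) :
    metricForm (basicMetric f) x (curvatureVec (basicMetric f) x (Pi.single i a) (Pi.single j b)
      (Pi.single j b)) (Pi.single i a) =
      (christoffelProd f x j i i j - christoffelProd f x i i j j) * (a ^ 2 * b ^ 2) := by
  have : Nontrivial (Fin n) := ⟨i, j, hij⟩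
  rw [metricForm_curvatureVec (basicMetric_symm f x)]
  rw [Fintype.sum_eq_single i fun p hp => by simp [hp],
    Fintype.sum_eq_single i fun p hp => by simp [hp],
    Fintype.sum_eq_single j fun p hp => by simp [hp],
    Fintype.sum_eq_single j fun p hp => by simp [hp],
    sum_basicMetric_mul_riemann hf hx]
  simp only [Pi.single_eq_same]
  ring

theorem gramDet_single {f : ℝ → ℝ} (hf : Admissible f) {n : ℕ} {x : Fin n → ℝ}
    (hx : x ∈ quadrant n) {i j : Fin n} (hij : i ≠ j) :
    gramDet (basicMetric f) x (Pi.single i (√(f (x i)))) (Pi.single j (√(f (x j)))) =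
      (f (∑ l, x l) - f (x i) - f (x j)) / f (∑ l, x l) := by
  have : NeZero n := ⟨by rintro rfl; exact i.elim0⟩
  have hF := (hf.pos (sum_pos_of_mem_quadrant hx)).ne'
  have hi := hf.pos (hx i)
  have hj := hf.pos (hx j)
  simp only [gramDet, metricForm_basicMetric, Pi.single_apply, mul_ite, mul_zero, ite_mul,
    zero_mul, ite_div, zero_div, Finset.sum_ite_eq', Finset.mem_univ, if_true, if_neg hij.symm]
  rw [Real.mul_self_sqrt hi.le, Real.mul_self_sqrt hj.le, div_self hi.ne', div_self hj.ne', zero_sub,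
    neg_sq, div_pow, mul_pow, Real.sq_sqrt hi.le, Real.sq_sqrt hj.le]
  field_simp
  ring

theorem sectionalCurvature_single {f : ℝ → ℝ} (hf : Admissible f) {n : ℕ} {x : Fin n → ℝ}
    (hx : x ∈ quadrant n) {i j : Fin n} (hij : i ≠ j) :
    sectionalCurvature (basicMetric f) x (Pi.single i (√(f (x i)))) (Pi.single j (√(f (x j)))) =
      (f (x i) * deriv f (x j) * deriv f (∑ l, x l) + deriv f (x i) * f (x j) * deriv f (∑ l, x l)
          - deriv f (x i) * deriv f (x j) * f (∑ l, x l))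
        / (4 * (f (∑ l, x l) - ∑ l, f (x l)) * (f (∑ l, x l) - f (x i) - f (x j))) := by
  have : Nontrivial (Fin n) := ⟨i, j, hij⟩
  have : NeZero n := ⟨by rintro rfl; exact i.elim0⟩
  have hF := (hf.pos (sum_pos_of_mem_quadrant hx)).ne'
  have hS : f (∑ i, x i) - ∑ i, f (x i) ≠ 0 := (sub_pos.2 (hf.sum_lt hx)).ne'
  have hD : f (∑ l, x l) - f (x i) - f (x j) ≠ 0 := by
    linarith [hf.add_lt_sum hx hij] |> ne_of_gt
  rw [sectionalCurvature, gramDet_single hf hx hij, basicMetric_curvature_single hf hx hij,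
    Real.sq_sqrt (hf.pos (hx i)).le, Real.sq_sqrt (hf.pos (hx j)).le, christoffelProd_sub hf hx hij]
  field_simp

/-! ### Gaussian curvature in dimension two -/

theorem basicMetric_curvature_two {f : ℝ → ℝ} (hf : Admissible f) {x : Fin 2 → ℝ}
    (hx : x ∈ quadrant 2) (u v : Fin 2 → ℝ) :
    metricForm (basicMetric f) x (curvatureVec (basicMetric f) x u v v) u =
      (christoffelProd f x 1 0 0 1 - christoffelProd f x 0 0 1 1) *
        (u 0 * v 1 - u 1 * v 0) ^ 2 := by
  have h1 := christoffelProd_comm f x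
  have h2 := christoffelProd_swap_left f x
  have h3 := christoffelProd_swap_right f x
  rw [metricForm_curvatureVec (basicMetric_symm f x)]
  simp only [sum_basicMetric_mul_riemann hf hx, Fin.sum_univ_two]
  -- Equal products are brought to a common form, so that the sixteen-term sum collapses to one
  -- coefficient times the squared determinant.
  rw [h1 1 1 0 0, h1 1 0 0 0, h1 1 1 0 1, h1 1 1 1 0, h1 0 1 0 0, h2 1 0 0 1, h2 1 0 1 1,
    h2 1 0 1 0, h3 0 1 1 0, h3 0 0 1 0]
  ring

theorem gramDet_two {f : ℝ → ℝ} (hf : Admissible f) {x : Fin 2 → ℝ} (hx : x ∈ quadrant 2)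
    (u v : Fin 2 → ℝ) :
    gramDet (basicMetric f) x u v =
      (f (x 0 + x 1) - f (x 0) - f (x 1)) / (f (x 0) * f (x 1) * f (x 0 + x 1)) *
        (u 0 * v 1 - u 1 * v 0) ^ 2 := by
  have hF := (hf.pos (add_pos (hx 0) (hx 1))).ne'
  have h0 := (hf.pos (hx 0)).ne'
  have h1 := (hf.pos (hx 1)).ne'
  simp only [gramDet, metricForm_basicMetric, Fin.sum_univ_two]
  field_simp
  ring

theorem det_ne_zero_of_linearIndependent {u v : Fin 2 → ℝ} (h : LinearIndependent ℝ ![u, v]) :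
    u 0 * v 1 - u 1 * v 0 ≠ 0 := by
  have h1 := (Matrix.linearIndependent_rows_iff_isUnit (A := Matrix.of ![u, v])).1 h
  have h2 := ((Matrix.isUnit_iff_isUnit_det _).1 h1).ne_zero
  simpa [Matrix.det_fin_two] using h2

end DirichletGeometry
end

open DirichletGeometry in
theorem proposition3p7 (f : ℝ → ℝ) (hf : Admissible f) :
    -- the general formula for the planes spanned by `e_i`, `e_j`
    (∀ (n : ℕ) (x : Fin n → ℝ), x ∈ quadrant n →
      -- `(M, ds²)` is identified with `Φ(M)` in Minkowski space by the isometric immersion `Φ`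
      Function.Injective (fderiv ℝ (Phi f) x) ∧
      (∀ u v : Fin n → ℝ,
        minkowski (fderiv ℝ (Phi f) x u) (fderiv ℝ (Phi f) x v)
          = metricForm (basicMetric f) x u v) ∧
      -- each `e_i` is tangent to `Φ(M)` at `Φ(x)`
      (∀ i : Fin n, ∃ u : Fin n → ℝ, fderiv ℝ (Phi f) x u = tangentVec f i (Phi f x)) ∧
      ∀ i j : Fin n, i ≠ j →
        0 < f (∑ l, x l) - ∑ l, f (x l) ∧
        0 < f (∑ l, x l) - f (x i) - f (x j) ∧
        ∀ u v : Fin n → ℝ,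
          fderiv ℝ (Phi f) x u = tangentVec f i (Phi f x) →
          fderiv ℝ (Phi f) x v = tangentVec f j (Phi f x) →
          0 < gramDet (basicMetric f) x u v ∧
          sectionalCurvature (basicMetric f) x u v =
            (f (x i) * deriv f (x j) * deriv f (∑ l, x l)
                + deriv f (x i) * f (x j) * deriv f (∑ l, x l)
                - deriv f (x i) * deriv f (x j) * f (∑ l, x l))
              / (4 * (f (∑ l, x l) - ∑ l, f (x l)) * (f (∑ l, x l) - f (x i) - f (x j)))) ∧
    -- the case `n = 2`: the Gaussian curvature
    (∀ x y : ℝ, 0 < x → 0 < y → ∀ u v : Fin 2 → ℝ, LinearIndependent ℝ ![u, v] →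
      0 < gramDet (basicMetric f) ![x, y] u v ∧
      sectionalCurvature (basicMetric f) ![x, y] u v =
        -(1 / 4) * ((f (x + y) * deriv f x * deriv f y - f x * deriv f (x + y) * deriv f y
            - f y * deriv f (x + y) * deriv f x)
          / (f (x + y) - f x - f y) ^ 2)) := by
  refine ⟨fun n x hx => ?_, fun x y hx hy u v huv => ?_⟩
  -- For `n = 0` the sum of coordinates is `0`, where nothing is known about `f`; there the tangent
  -- space is trivial.
  · rcases Nat.eq_zero_or_pos n with rfl | hn
    · refine ⟨Function.injective_of_subsingleton _, fun u v => ?_, fun i => i.elim0,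
        fun i => i.elim0⟩
      rw [Subsingleton.elim u 0, Subsingleton.elim v 0, map_zero]
      simp [minkowski, metricForm]
    have : NeZero n := ⟨hn.ne'⟩
    refine ⟨injective_fderiv_Phi hf hx, minkowski_fderiv_Phi hf hx,
      fun i => ⟨_, (fderiv_Phi_eq_tangentVec_iff hf hx _ i).2 rfl⟩, fun i j hij => ?_⟩
    have : Nontrivial (Fin n) := ⟨i, j, hij⟩
    have hD : 0 < f (∑ l, x l) - f (x i) - f (x j) := by linarith [hf.add_lt_sum hx hij]
    refine ⟨sub_pos.2 (hf.sum_lt hx), hD, fun u v hu hv => ?_⟩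
    rw [fderiv_Phi_eq_tangentVec_iff hf hx] at hu hv
    subst hu hv
    exact ⟨gramDet_single hf hx hij ▸ div_pos hD (hf.pos (sum_pos_of_mem_quadrant hx)),
      sectionalCurvature_single hf hx hij⟩
  · have hq : ![x, y] ∈ quadrant 2 := by
      intro i
      fin_cases i
      exacts [hx, hy]
    have hd := det_ne_zero_of_linearIndependent huv
    have hg := gramDet_two hf hq u v
    have hK := christoffelProd_sub hf hq (i := 0) (j := 1) (by decide)
    simp only [Matrix.cons_val_zero, Matrix.cons_val_one, Fin.sum_univ_two] at hg hK
    have hF := hf.pos (add_pos hx hy)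
    have h0 := hf.pos hx
    have h1 := hf.pos hy
    have hD : 0 < f (x + y) - f x - f y := by linarith [hf.add_lt hx hy]
    constructor
    · rw [hg]
      positivity
    · rw [← eq_div_iff (by positivity)] at hK
      rw [sectionalCurvature, hg, basicMetric_curvature_two hf hq, hK, ← sub_sub]
      have hF' := hF.ne'
      have h0' := h0.ne'
      have h1' := h1.ne'
      have hD' := hD.ne'
      field_simp
      ring
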